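/- Let $\mathbb{D}=\{z\in\mathbb{C}:|z|<1\}$. A function is univalent if it is analytic and injective in $\mathbb{D}$, and $\mathcal{A}$ is the class of univalent functions in $\mathbb{D}$ of the form $f(z)=z+\sum_{n\ge1}a_{n+1}z^{n+1}$. Write $f\prec F$ ($f$ is subordinate to $F$) if there is a function $w$ analytic in $\mathbb{D}$ with $|w(z)|\le|z|$ and $f(z)=F(w(z))$ for all $z\in\mathbb{D}$. For $\nu\in\mathbb{C}\setminus\{0,-1,-2,\dots\}$, $c\in\mathbb{C}$ and $f\in\mathcal{A}$ as above put $$B_{\nu,c}(f)(z)=z+\sum_{n\ge1}a_{n+1}\frac{(-c/4)^n}{(\nu)_n}\frac{z^{n+1}}{n!},\qquad (\nu)_n=\nu(\nu+1)\cdots(\nu+n-1);$$ the function $z\mapsto B_{\nu,c}(f)(z)/z$ is given the value $1$ at $z=0$. For $\phi:\mathbb{C}^2\to\mathbb{C}$ and $h$ univalent in $\mathbb{D}$, a solution of the differential subordination $\phi(\rho(z),z\rho'(z))\prec h(z)$ is a function $\rho$ analytic in $\mathbb{D}$ that satisfies it; a dominant is a univalent function $q$ with $\rho\prec q$ for every solution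 $\rho$; a best dominant is a dominant $\tilde q$ with $\tilde q\prec q$ for every dominant $q$. **Theorem.** Let $g\in\mathcal{A}$, $\lambda\in[0,1)$, $c\in\mathbb{C}$ with $c\ne0$, and let $p,b\in\mathbb{R}$ be such that $\kappa=p+\frac{b+1}{2}>-1$. For $f\in\mathcal{A}$ put $$\Phi_f(z)=(1-\lambda)\frac{B_{\kappa+1,c}(f)(z)}{z}+\lambda\frac{B_{\kappa+2,c}(f)(z)}{z},$$ and let $\Phi=\Phi_g$. Suppose that for all $z\in\mathbb{D}$ we have $\Phi'(z)\neq0$ and $$\operatorname{Re}\left(1+\frac{z\Phi''(z)}{\Phi'(z)}\right)>-\gamma_{\lambda,\kappa},\qquad \gamma_{\lambda,\kappa}=\frac{(1-\lambda)^2+(\kappa+1)^2-\sqrt{(1-\lambda)^4+(\kappa+1)^4}}{4(1-\lambda)(\kappa+1)}.$$ Then for every $f\in\mathcal{A}$ $$\Phi_f(z)\prec\Phi(z)\quad\text{implies}\quad\frac{B_{\kappa+2,c}(f)(z)}{z}\prec\frac{B_{\kappa+2,c}(g)(z)}{z}.$$ Moreover, $z\mapsto B_{\kappa+2,c}(g)(z)/z$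 is the best dominant: $\Phi$ is univalent and this function is a best dominant of the differential subordination $$\rho(z)+\frac{1-\lambda}{\kappa+1}\,z\rho'(z)\prec\Phi(z),$$ and also $B_{\kappa+2,c}(g)(z)/z\prec q(z)$ for every univalent $q$ such that $B_{\kappa+2,c}(f)(z)/z\prec q(z)$ for all $f\in\mathcal{A}$ with $\Phi_f\prec\Phi$. -/

import Mathlib

noncomputable section

namespace BesselSubordination

/-- The open unit disk in the complex plane. -/
def unitDisk : Set ℂ := Metric.ball (0 : ℂ) 1

/-- `F` is univalent in the unit disk: analytic and injective there. -/
def Univalent (F : ℂ → ℂ) : Prop :=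
  DifferentiableOn ℂ F unitDisk ∧ Set.InjOn F unitDisk

/-- The class of analytic and univalent functions `f(z) = z + a₂ z² + a₃ z³ + ⋯` in the disk. -/
def ClassA (f : ℂ → ℂ) : Prop :=
  Univalent f ∧ f 0 = 0 ∧ deriv f 0 = 1

/-- `f ≺ F`: there is a function `w`, analytic in the disk, with `|w(z)| ≤ |z|` and
`f(z) = F(w(z))` for all `z` in the disk. -/
def Subordinate (f F : ℂ → ℂ) : Prop :=
  ∃ w : ℂ → ℂ, DifferentiableOn ℂ w unitDisk ∧
    ∀ z ∈ unitDisk, ‖w z‖ ≤ ‖z‖ ∧ f z = F (w z)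

/-- The `n`-th Taylor coefficient of `f` at the origin. -/
def taylorCoeff (f : ℂ → ℂ) (n : ℕ) : ℂ :=
  iteratedDeriv n f 0 / (n.factorial : ℂ)

/-- The coefficient `(-c/4)^n / ((κ)_n n!)` of `z^n` in the normalized generalized Bessel function,
where `(κ)_n = κ (κ + 1) ⋯ (κ + n - 1)`. -/
def besselCoeff (κ c : ℂ) (n : ℕ) : ℂ :=
  (-c / 4) ^ n / ((ascPochhammer ℂ n).eval κ * (n.factorial : ℂ))

/-- The operator `B_{κ,c}`: the Hadamard product of `f` with `z ↦ z u(z)`, where `u` is the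
normalized generalized Bessel function. The term `n = 0` is `z` when `f'(0) = 1`. -/
def besselOp (κ c : ℂ) (f : ℂ → ℂ) (z : ℂ) : ℂ :=
  ∑' n : ℕ, taylorCoeff f (n + 1) * besselCoeff κ c n * z ^ (n + 1)

/-- The analytic function `z ↦ B_{κ,c}(f)(z) / z`, with the removable singularity at the origin
filled in by the value `1`, for `f` with `f'(0) = 1`. -/
def besselQuot (κ c : ℂ) (f : ℂ → ℂ) : ℂ → ℂ :=
  Function.update (fun z => besselOp κ c f z / z) 0 1

/-- The power series of `B_{κ,c}(f)(z) / z`; in particular the value at the origin is right. -/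
theorem besselQuot_eq_tsum (κ c : ℂ) {f : ℂ → ℂ} (hf : deriv f 0 = 1) (z : ℂ) :
    besselQuot κ c f z = ∑' n : ℕ, taylorCoeff f (n + 1) * besselCoeff κ c n * z ^ n := by
  unfold besselQuot
  by_cases hz : z = 0
  · subst hz
    rw [Function.update_self, tsum_eq_single 0]
    · simp [taylorCoeff, besselCoeff, hf]
    · intro n hn
      simp [hn]
  · rw [Function.update_of_ne hz]
    unfold besselOp
    rw [← tsum_div_const]
    refine tsum_congr fun n => ?_
    field_simp
    ring

/-- `z ↦ (1 - l) B_{κ+1,c}(f)(z)/z + l B_{κ+2,c}(f)(z)/z`. -/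
def besselMix (l κ : ℝ) (c : ℂ) (f : ℂ → ℂ) (z : ℂ) : ℂ :=
  (1 - (l : ℂ)) * besselQuot ((κ : ℂ) + 1) c f z + (l : ℂ) * besselQuot ((κ : ℂ) + 2) c f z

/-- The explicit constant `γ_{l,κ}`. -/
def gammaConst (l κ : ℝ) : ℝ :=
  ((1 - l) ^ 2 + (κ + 1) ^ 2 - Real.sqrt ((1 - l) ^ 4 + (κ + 1) ^ 4)) /
    (4 * (1 - l) * (κ + 1))

/-- `p` is a solution of the first-order differential subordination `ϕ(p(z), z p'(z)) ≺ h(z)`. -/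
def IsSolution (ϕ : ℂ → ℂ → ℂ) (h p : ℂ → ℂ) : Prop :=
  DifferentiableOn ℂ p unitDisk ∧ Subordinate (fun z => ϕ (p z) (z * deriv p z)) h

/-- `q` is a dominant of `ϕ(p(z), z p'(z)) ≺ h(z)`: a univalent function to which every solution
is subordinate. -/
def IsDominant (ϕ : ℂ → ℂ → ℂ) (h q : ℂ → ℂ) : Prop :=
  Univalent q ∧ ∀ p : ℂ → ℂ, IsSolution ϕ h p → Subordinate p q

/-- `q` is the best dominant of `ϕ(p(z), z p'(z)) ≺ h(z)`, where `h` is univalent: a dominant that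
is subordinate to every dominant. -/
def IsBestDominant (ϕ : ℂ → ℂ → ℂ) (h q : ℂ → ℂ) : Prop :=
  Univalent h ∧ IsDominant ϕ h q ∧ ∀ q' : ℂ → ℂ, IsDominant ϕ h q' → Subordinate q q'

end BesselSubordination

end

/-!
Write `q_f = B_{κ+2,c}(f) / z` and `α = (1 - l) / (κ + 1) > 0`. Since `1 / (ν)_n` is
`(1 + n / ν) / (ν + 1)_n`, comparing power series gives `Φ_f = q_f + α z q_f'`
(`besselQuot_add_mul_deriv`). So the theorem is a statement about the differential subordination
`ρ + α z ρ' ≺ Φ = q + α z q'` with `q = q_g`.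

The function `q` is convex, that is, `q' ≠ 0` and `P = 1 + z q'' / q'` has positive real part
(`convex_of_add_mul_deriv`). Indeed `P + z P' / (P + 1/α) = 1 + z Φ'' / Φ'`, and at the first point
where `Re P > 0` fails, Jack's lemma for `(P - 1) / (P + 1)` makes the real part of the left-hand
side at most `-min(α, 1/α) / 2 ≤ -γ`.

A convex `q` maps each circle `|z| = r` to a curve with monotonically turning tangent, so that
`q(|z| ≤ |ζ|)` lies on the inner side of its tangent line at `q(ζ)` (`IsConvexFunction.re_neg`); hence
`q` is injective with convex image. As `Φ' / q' = 1 + α P` has positive real part, the mean value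
inequality along segments of the convex set `q(𝔻)` shows that `Φ` is injective, and that the ray from
`Φ(ζ)` in the direction of the outer normal `ζ q'(ζ)` stays outside `Φ(|z| < |ζ|)`
(`IsConvexFunction.ne_add_mul_normal`). If `ρ` were not subordinate to `q`, Jack's lemma for
`w = q⁻¹ ∘ ρ` would produce a point where `ρ + α z ρ'` lies on such a ray with `|ζ| > |z|`, which the
subordination to `Φ` forbids (`IsConvexFunction.subordinate_of_add_mul_deriv`).

The two sharpness claims hold because `q` is itself a solution, the one that comes from `f = g`.
-/

open Metric Set Filter Topology

namespace BesselSubordination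

/-! ### Jack's lemma -/

lemma isOpen_unitDisk : IsOpen unitDisk := isOpen_ball

lemma mem_unitDisk {z : ℂ} : z ∈ unitDisk ↔ ‖z‖ < 1 := by simp [unitDisk]

lemma nonpos_of_hasDerivAt_of_le {g : ℝ → ℝ} {g' : ℝ} (hg : HasDerivAt g g' 0)
    (hle : ∀ t, 0 < t → g t ≤ g 0) : g' ≤ 0 := by
  have h := (hasDerivWithinAt_iff_tendsto_slope' (s := Ioi (0 : ℝ)) (by simp)).1
    hg.hasDerivWithinAt
  refine le_of_tendsto h ?_
  filter_upwards [self_mem_nhdsWithin] with t ht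
  rw [slope_def_field, sub_zero]
  exact div_nonpos_of_nonpos_of_nonneg (sub_nonpos.2 (hle t ht)) (le_of_lt ht)

/-- **Jack's lemma**: if `|V|` attains its maximum over the disk `|z| ≤ |z₀|` at `z₀`, then
`z₀ V'(z₀)` is a real multiple, by a factor at least one, of `V(z₀)`. In the logarithmic coordinate
`z = z₀ e^u` the Schwarz lemma says that `V(z₀ e^u) e^{-u} / V(z₀)` is bounded by its value `1` at
`u = 0` on the half-plane `Re u ≤ 0`, which leaves no choice for its derivative but to be real and
nonnegative. -/
lemma exists_real_mul_of_isMaxOn {V : ℂ → ℂ} {z₀ : ℂ}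
    (hd : DifferentiableOn ℂ V (ball 0 ‖z₀‖)) (hz : DifferentiableAt ℂ V z₀) (h0 : V 0 = 0)
    (hV : V z₀ ≠ 0) (hmax : ∀ z ∈ closedBall (0 : ℂ) ‖z₀‖, ‖V z‖ ≤ ‖V z₀‖) :
    ∃ m : ℝ, 1 ≤ m ∧ z₀ * deriv V z₀ = m * V z₀ := by
  have hz₀ : 0 < ‖z₀‖ := by
    rw [norm_pos_iff]
    rintro rfl
    exact hV h0
  set c : ℂ := z₀ * deriv V z₀ / V z₀ with hc
  have hbound : ∀ u : ℂ, u.re ≤ 0 → ‖V (z₀ * Complex.exp u)‖ ≤ Real.exp u.re * ‖V z₀‖ := by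
    intro u hu
    rcases hu.lt_or_eq with hu | hu
    · have hlt : ‖z₀ * Complex.exp u‖ < ‖z₀‖ := by
        rw [norm_mul, Complex.norm_exp]
        exact mul_lt_of_lt_one_right hz₀ (by simpa using hu)
      have := Complex.dist_le_div_mul_dist_of_mapsTo_ball (c := 0) (R₂ := ‖V z₀‖) hd
        (fun z hz => by
          rw [h0, mem_closedBall_zero_iff]
          exact hmax z (ball_subset_closedBall hz)) (mem_ball_zero_iff.2 hlt)
      rw [h0, dist_zero_right, dist_zero_right, norm_mul, Complex.norm_exp] at this
      refine this.trans_eq ?_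
      field_simp
    · rw [hu, Real.exp_zero, one_mul]
      refine hmax _ ?_
      rw [mem_closedBall_zero_iff, norm_mul, Complex.norm_exp, hu, Real.exp_zero, mul_one]
  have hdir : ∀ v : ℂ, v.re ≤ 0 → ((c - 1) * v).re ≤ 0 := by
    intro v hv
    set F : ℂ → ℂ := fun u => V (z₀ * Complex.exp u) * Complex.exp (-u) / V z₀ with hF
    have hF' : HasDerivAt F (c - 1) 0 := by
      have h1 : HasDerivAt (fun u : ℂ => z₀ * Complex.exp u) z₀ 0 := by
        simpa using (Complex.hasDerivAt_exp 0).const_mul z₀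
      have h2 : HasDerivAt V (deriv V z₀) (z₀ * Complex.exp 0) := by
        simpa using hz.hasDerivAt
      have h3 : HasDerivAt (fun u : ℂ => Complex.exp (-u)) (-1) 0 := by
        simpa using (hasDerivAt_neg (0 : ℂ)).cexp
      refine (((h2.comp (0 : ℂ) h1).mul h3).div_const (V z₀)).congr_deriv ?_
      simp only [Function.comp_apply, Complex.exp_zero, neg_zero, mul_one, hc]
      field_simp
      ring
    have hline : HasDerivAt (fun t : ℝ => (F (t * v)).re) ((c - 1) * v).re 0 := by
      have h1 : HasDerivAt (fun t : ℂ => t * v) v ((0 : ℝ) : ℂ) := by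
        simpa using (hasDerivAt_id ((0 : ℝ) : ℂ)).mul_const v
      have h2 : HasDerivAt F (c - 1) (((0 : ℝ) : ℂ) * v) := by simpa using hF'
      exact (HasDerivAt.comp (h := fun t : ℂ => t * v) _ h2 h1).real_of_complex
    refine nonpos_of_hasDerivAt_of_le hline fun t ht => ?_
    have hre : ((t : ℂ) * v).re ≤ 0 := by
      simpa using mul_nonpos_of_nonneg_of_nonpos ht.le hv
    have h1 : (F (((0 : ℝ) : ℂ) * v)).re = 1 := by simp [hF, hV]
    rw [h1]
    refine (Complex.re_le_norm _).trans ?_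
    rw [hF]
    simp only [norm_div, norm_mul, Complex.norm_exp]
    rw [div_le_one (norm_pos_iff.2 hV)]
    calc _ ≤ Real.exp (t * v).re * ‖V z₀‖ * Real.exp (-(t * v)).re := by
          gcongr
          exact hbound _ hre
      _ = ‖V z₀‖ := by
          rw [mul_right_comm, ← Real.exp_add]
          simp
  have him : c.im = 0 := by
    have h1 := hdir Complex.I (by simp)
    have h2 := hdir (-Complex.I) (by simp)
    simp at h1 h2
    linarith
  have hre : 1 ≤ c.re := by
    have h1 := hdir (-1) (by simp)
    simp at h1
    linarith
  refine ⟨c.re, hre, ?_⟩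
  have : ((c.re : ℝ) : ℂ) = c := by
    apply Complex.ext <;> simp [him]
  rw [this, hc]
  field_simp

/-- Jack's lemma for a quotient `N / M` that starts at `0` and leaves the unit disk: at a first
point `z₀` with `|N| = |M|`, the quotient has `z V' = m V` with `m ≥ 1`, here written without
division. The denominator may vanish further out. -/
lemma exists_first_exit {N M : ℂ → ℂ} (hN : DifferentiableOn ℂ N unitDisk)
    (hM : DifferentiableOn ℂ M unitDisk) (h0 : N 0 = 0)
    (hne : ∀ z ∈ unitDisk, N z = 0 → M z ≠ 0) (hex : ∃ z ∈ unitDisk, ‖M z‖ ≤ ‖N z‖) :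
    ∃ z₀ ∈ unitDisk, M z₀ ≠ 0 ∧ ‖N z₀‖ = ‖M z₀‖ ∧ ∃ m : ℝ, 1 ≤ m ∧
      z₀ * deriv N z₀ * M z₀ - N z₀ * (z₀ * deriv M z₀) = m * N z₀ * M z₀ := by
  obtain ⟨z₁, hz₁, hle₁⟩ := hex
  have hsub : closedBall (0 : ℂ) ‖z₁‖ ⊆ unitDisk :=
    closedBall_subset_ball (mem_unitDisk.1 hz₁)
  have hK : IsCompact {z ∈ closedBall (0 : ℂ) ‖z₁‖ | ‖M z‖ ≤ ‖N z‖} := by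
    refine (isCompact_closedBall (0 : ℂ) ‖z₁‖).of_isClosed_subset ?_ (sep_subset _ _)
    exact isClosed_closedBall.isClosed_le (hM.continuousOn.mono hsub).norm
      (hN.continuousOn.mono hsub).norm
  obtain ⟨z₀, ⟨hz₀, hle₀⟩, hmin⟩ := hK.exists_isMinOn ⟨z₁, by simp, hle₁⟩ continuous_norm.continuousOn
  have hz₀D : z₀ ∈ unitDisk := hsub hz₀
  have hz₀1 := mem_unitDisk.1 hz₀D
  have hin : ∀ z ∈ ball (0 : ℂ) ‖z₀‖, ‖N z‖ < ‖M z‖ := by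
    intro z hz
    by_contra! hcon
    have hzn := mem_ball_zero_iff.1 hz
    have := hmin ⟨mem_closedBall_zero_iff.2 (hzn.le.trans (mem_closedBall_zero_iff.1 hz₀)), hcon⟩
    exact absurd hzn (not_lt.2 this)
  have hz₀ne : z₀ ≠ 0 := by
    rintro rfl
    rw [h0, norm_zero, norm_le_zero_iff] at hle₀
    exact hne 0 hz₀D h0 hle₀
  have hcl : ∀ z ∈ closedBall (0 : ℂ) ‖z₀‖, ‖N z‖ ≤ ‖M z‖ := by
    intro z hz
    have hzD : z ∈ unitDisk :=
      mem_unitDisk.2 ((mem_closedBall_zero_iff.1 hz).trans_lt hz₀1)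
    have hzc : z ∈ closure (ball (0 : ℂ) ‖z₀‖) := by
      rwa [closure_ball _ (norm_ne_zero_iff.2 hz₀ne)]
    refine ContinuousWithinAt.closure_le hzc ?_ ?_ fun y hy => (hin y hy).le
    · exact (hN.differentiableAt (isOpen_unitDisk.mem_nhds hzD)).continuousAt.norm.continuousWithinAt
    · exact (hM.differentiableAt (isOpen_unitDisk.mem_nhds hzD)).continuousAt.norm.continuousWithinAt
  have heq : ‖N z₀‖ = ‖M z₀‖ := le_antisymm (hcl z₀ (by simp)) hle₀
  have hM₀ : M z₀ ≠ 0 := by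
    intro h
    rw [h, norm_zero, norm_eq_zero] at heq
    exact hne z₀ hz₀D heq h
  have hN₀ : N z₀ ≠ 0 := by
    rw [← norm_ne_zero_iff, heq]
    exact norm_ne_zero_iff.2 hM₀
  have hNd := hN.differentiableAt (isOpen_unitDisk.mem_nhds hz₀D)
  have hMd := hM.differentiableAt (isOpen_unitDisk.mem_nhds hz₀D)
  have hsub' : ball (0 : ℂ) ‖z₀‖ ⊆ unitDisk := ball_subset_ball hz₀1.le
  obtain ⟨m, hm, hJ⟩ := exists_real_mul_of_isMaxOn (V := fun z => N z / M z) (z₀ := z₀)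
    ((hN.mono hsub').div (hM.mono hsub') fun z hz h => by
      have := hin z hz
      rw [h, norm_zero] at this
      exact absurd this (not_lt.2 (norm_nonneg _)))
    (hNd.div hMd hM₀) (by simp [h0]) (div_ne_zero hN₀ hM₀) (by
      intro z hz
      rw [norm_div, norm_div, heq, div_self (norm_ne_zero_iff.2 hM₀)]
      exact div_le_one_of_le₀ (hcl z hz) (norm_nonneg _))
  refine ⟨z₀, hz₀D, hM₀, heq, m, hm, ?_⟩
  rw [(hNd.hasDerivAt.fun_div hMd.hasDerivAt hM₀).deriv] at hJ
  field_simp at hJ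
  linear_combination hJ

/-! ### Convexity of the solution of `q + α z q' = Φ` -/

/-- The boundary computation for `P = 1 + b / a` of modulus `|P - 1| = |P + 1|`, that is, for purely
imaginary `P`. Here `a`, `b`, `d` stand for `q'`, `z q''`, `z² q'''`; the hypothesis `hJ` is Jack's
lemma for `(P - 1) / (P + 1) = b / (2 a + b)`. -/
lemma exists_re_eq_of_jack {a b d : ℂ} {α m : ℝ} (hα : 0 < α) (hm : 1 ≤ m)
    (hM : 2 * a + b ≠ 0) (hnorm : ‖b‖ = ‖2 * a + b‖)
    (hJ : (b + d) * (2 * a + b) - b * (3 * b + d) = m * b * (2 * a + b)) :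
    ∃ y : ℝ, (((1 + 2 * α) * b + α * d) / ((1 + α) * a + α * b) + 1).re =
      -(m * (α * (1 + y ^ 2) / (2 * (1 + α ^ 2 * y ^ 2)))) := by
  have ha : a ≠ 0 := by
    rintro rfl
    have hb : b ≠ 0 := by simpa using hM
    have h1 : ((m + 2 : ℝ) : ℂ) * b ^ 2 = 0 := by
      push_cast
      linear_combination -hJ
    have h2 : (m + 2 : ℝ) ≠ 0 := by positivity
    exact mul_ne_zero (Complex.ofReal_ne_zero.2 h2) (pow_ne_zero 2 hb) h1
  obtain ⟨p, rfl⟩ : ∃ p, b = p * a - a := ⟨b / a + 1, by field_simp; ring⟩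
  obtain ⟨e, rfl⟩ : ∃ e, d = e * a := ⟨d / a, by field_simp⟩
  have hp : p.re = 0 := by
    have h1 : ‖p - 1‖ = ‖p + 1‖ := by
      have e1 : p * a - a = (p - 1) * a := by ring
      have e2 : 2 * a + (p * a - a) = (p + 1) * a := by ring
      rw [e2, e1, norm_mul, norm_mul] at hnorm
      exact mul_right_cancel₀ (norm_ne_zero_iff.2 ha) hnorm
    have h2 : Complex.normSq (p - 1) = Complex.normSq (p + 1) := by
      rw [Complex.normSq_eq_norm_sq, Complex.normSq_eq_norm_sq, h1]
    simp only [Complex.normSq_apply, Complex.sub_re, Complex.sub_im, Complex.add_re,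
      Complex.add_im, Complex.one_re, Complex.one_im] at h2
    linarith
  obtain ⟨y, rfl⟩ : ∃ y : ℝ, p = y * Complex.I := ⟨p.im, by apply Complex.ext <;> simp [hp]⟩
  refine ⟨y, ?_⟩
  have hI := Complex.I_sq
  have he : 2 * e = (1 - m) * (1 + y ^ 2) + 3 * (y * Complex.I - 1) ^ 2 := by
    have : a ^ 2 ≠ 0 := pow_ne_zero 2 ha
    apply mul_left_cancel₀ this
    linear_combination hJ + a ^ 2 * y ^ 2 * (m - 1) * hI
  have hden : (1 + α * (y * Complex.I) : ℂ) ≠ 0 := by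
    intro h
    simpa using congrArg Complex.re h
  have hX : ((1 + 2 * α) * (y * Complex.I * a - a) + α * (e * a)) /
      ((1 + α) * a + α * (y * Complex.I * a - a)) + 1 =
      (((-(α * m * (1 + y ^ 2)) / 2 - α * y ^ 2 : ℝ) : ℂ) + (y : ℝ) * Complex.I) /
        (((1 : ℝ) : ℂ) + ((α * y : ℝ) : ℂ) * Complex.I) := by
    have e1 : (1 + α) * a + α * (y * Complex.I * a - a) = (1 + α * (y * Complex.I)) * a := by ring
    have hden' : (((1 : ℝ) : ℂ) + ((α * y : ℝ) : ℂ) * Complex.I) ≠ 0 := by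
      convert hden using 1
      push_cast
      ring
    rw [e1, eq_div_iff hden', div_add_one (mul_ne_zero hden ha), div_mul_eq_mul_div,
      div_eq_iff (mul_ne_zero hden ha)]
    push_cast
    linear_combination (1 + α * (y * Complex.I)) * a * (α / 2 * he + 3 / 2 * α * y ^ 2 * hI)
  have hre : ∀ R s t : ℝ, (((R : ℂ) + (s : ℂ) * Complex.I) /
      (((1 : ℝ) : ℂ) + (t : ℂ) * Complex.I)).re = (R + s * t) / (1 + t ^ 2) := by
    intro R s t
    simp [Complex.div_re, Complex.normSq_apply, ← pow_two, add_div]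
  rw [hX, hre]
  have hpos : 0 < 1 + α ^ 2 * y ^ 2 := by positivity
  rw [mul_pow]
  field_simp
  ring

lemma hasDerivAt_deriv {q : ℂ → ℂ} (hq : DifferentiableOn ℂ q unitDisk) {z : ℂ}
    (hz : z ∈ unitDisk) : HasDerivAt q (deriv q z) z :=
  (hq.differentiableAt (isOpen_unitDisk.mem_nhds hz)).hasDerivAt

lemma deriv_add_mul_deriv {q Φ : ℂ → ℂ} {α : ℂ} (hq : DifferentiableOn ℂ q unitDisk)
    (hΦ : ∀ z ∈ unitDisk, Φ z = q z + α * (z * deriv q z)) {z : ℂ} (hz : z ∈ unitDisk) :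
    deriv Φ z = (1 + α) * deriv q z + α * (z * deriv (deriv q) z) := by
  have h2 := hasDerivAt_deriv (hq.deriv isOpen_unitDisk) hz
  rw [(eventuallyEq_of_mem (isOpen_unitDisk.mem_nhds hz) hΦ).deriv_eq]
  refine ((hasDerivAt_deriv hq hz).add (((hasDerivAt_id z).mul h2).const_mul α)).deriv.trans ?_
  simp only [id]
  ring

/-- The differential equation `q + α z q' = Φ` inherits convexity: if
`Re (1 + z Φ'' / Φ') > -δ` with `δ` small in terms of `α`, then `Re (1 + z q'' / q') > 0`. In
particular `q'` has no zero. -/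
lemma convex_of_add_mul_deriv {q Φ : ℂ → ℂ} {α δ : ℝ} (hα : 0 < α)
    (hq : DifferentiableOn ℂ q unitDisk)
    (hΦ : ∀ z ∈ unitDisk, Φ z = q z + α * (z * deriv q z))
    (hΦ' : ∀ z ∈ unitDisk, deriv Φ z ≠ 0 ∧ -δ < (z * deriv (deriv Φ) z / deriv Φ z + 1).re)
    (hδ : ∀ y : ℝ, δ ≤ α * (1 + y ^ 2) / (2 * (1 + α ^ 2 * y ^ 2))) {z : ℂ} (hz : z ∈ unitDisk) :
    deriv q z ≠ 0 ∧ 0 < (1 + z * deriv (deriv q) z / deriv q z).re := by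
  have hq1 := hq.deriv isOpen_unitDisk
  have hq2 := hq1.deriv isOpen_unitDisk
  have hΦ1 : ∀ z ∈ unitDisk, deriv Φ z = (1 + α) * deriv q z + α * (z * deriv (deriv q) z) :=
    fun z hz => deriv_add_mul_deriv hq hΦ hz
  have hΦ2 : ∀ z ∈ unitDisk, deriv (deriv Φ) z =
      (1 + 2 * α) * deriv (deriv q) z + α * (z * deriv (deriv (deriv q)) z) := by
    intro z hz
    rw [(eventuallyEq_of_mem (isOpen_unitDisk.mem_nhds hz) hΦ1).deriv_eq]
    refine (((hasDerivAt_deriv hq1 hz).const_mul (1 + α : ℂ)).add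
      (((hasDerivAt_id z).mul (hasDerivAt_deriv hq2 hz)).const_mul (α : ℂ))).deriv.trans ?_
    simp only [id]
    ring
  -- This is `|P - 1| < |P + 1|`, that is, `Re P > 0` for `P = 1 + z q'' / q'`, with the denominator
  -- `q'` cleared: its zeros are not excluded yet.
  have key : ∀ z ∈ unitDisk, ‖z * deriv (deriv q) z‖ <
      ‖2 * deriv q z + z * deriv (deriv q) z‖ := by
    by_contra! hex
    have hN : DifferentiableOn ℂ (fun z => z * deriv (deriv q) z) unitDisk :=
      differentiableOn_id.mul hq2
    obtain ⟨z₀, hz₀, hM₀, hnorm, m, hm, hJ⟩ := exists_first_exit hN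
      ((hq1.const_mul 2).add hN) (by simp) (by
        intro z hz h1 h2
        refine (hΦ' z hz).1 ?_
        simp only [Pi.add_apply, h1, add_zero, mul_eq_zero, OfNat.ofNat_ne_zero, false_or] at h2
        rw [hΦ1 z hz, h1, h2]
        simp) hex
    have hN' := (hasDerivAt_id z₀).fun_mul (hasDerivAt_deriv hq2 hz₀)
    have hM' := ((hasDerivAt_deriv hq1 hz₀).const_mul (2 : ℂ)).add hN'
    simp only [id] at hN' hM'
    rw [hM'.deriv, hN'.deriv] at hJ
    simp only [Pi.add_apply] at hJ hM₀ hnorm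
    obtain ⟨y, hy⟩ := exists_re_eq_of_jack (d := z₀ ^ 2 * deriv (deriv (deriv q)) z₀) hα hm hM₀
      hnorm (by linear_combination hJ)
    have h1 := (hΦ' z₀ hz₀).2
    have e1 : z₀ * deriv (deriv Φ) z₀ = (1 + 2 * α) * (z₀ * deriv (deriv q) z₀) +
        α * (z₀ ^ 2 * deriv (deriv (deriv q)) z₀) := by
      rw [hΦ2 z₀ hz₀]
      ring
    rw [e1, hΦ1 z₀ hz₀, hy] at h1
    have h2 : 0 ≤ α * (1 + y ^ 2) / (2 * (1 + α ^ 2 * y ^ 2)) := by positivity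
    nlinarith [hδ y]
  have hlt := key z hz
  have ha : deriv q z ≠ 0 := by
    intro h
    simp [h] at hlt
  refine ⟨ha, ?_⟩
  set p := 1 + z * deriv (deriv q) z / deriv q z with hp
  have e1 : z * deriv (deriv q) z = (p - 1) * deriv q z := by
    rw [hp]
    field_simp
    ring
  have e2 : 2 * deriv q z + z * deriv (deriv q) z = (p + 1) * deriv q z := by
    rw [e1]
    ring
  rw [e2, e1, norm_mul, norm_mul] at hlt
  have h1 : ‖p - 1‖ < ‖p + 1‖ := lt_of_mul_lt_mul_right hlt (norm_nonneg _)
  have h2 : Complex.normSq (p - 1) < Complex.normSq (p + 1) := by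
    rw [Complex.normSq_eq_norm_sq, Complex.normSq_eq_norm_sq]
    gcongr
  simp only [Complex.normSq_apply, Complex.sub_re, Complex.sub_im, Complex.add_re,
    Complex.add_im, Complex.one_re, Complex.one_im] at h2
  linarith

/-! ### Geometry of convex functions -/

/-- The analytic condition for a convex function: `q` is analytic in the disk and locally injective,
and the tangent direction of each image circle `q(|z| = r)` turns monotonically. -/
def IsConvexFunction (q : ℂ → ℂ) : Prop :=
  DifferentiableOn ℂ q unitDisk ∧
    ∀ z ∈ unitDisk, deriv q z ≠ 0 ∧ 0 < (1 + z * deriv (deriv q) z / deriv q z).re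

/-- Let `e` be a closed curve with `e' = i T` and `T' = i T p`, where `Re p > 0` and `p` has mean
`1`. Then `e` stays strictly on one side of its tangent at the starting point: the angle between
`T 0` and `T` increases from `0` to `2π`, so that the component of `e - e 0` along the normal `T 0`
first decreases and then increases, and it ends where it began. -/
lemma re_neg_of_turning {e T p : ℝ → ℂ} (he : ∀ t, HasDerivAt e (Complex.I * T t) t)
    (hT : ∀ t, HasDerivAt T (Complex.I * T t * p t) t) (hp : Continuous p)
    (hpos : ∀ t, 0 < (p t).re) (hint : ∫ t in (0 : ℝ)..2 * Real.pi, p t = 2 * Real.pi)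
    (hT0 : T 0 ≠ 0) (hper : e (2 * Real.pi) = e 0) {t : ℝ} (ht : t ∈ Ioo 0 (2 * Real.pi)) :
    ((e t - e 0) / T 0).re < 0 := by
  set Ψ : ℝ → ℂ := fun t => ∫ s in (0 : ℝ)..t, p s with hΨ
  have hΨ' : ∀ t, HasDerivAt Ψ (p t) t := fun t =>
    intervalIntegral.integral_hasDerivAt_right (hp.intervalIntegrable _ _)
      (hp.stronglyMeasurableAtFilter _ _) hp.continuousAt
  have hΨ0 : Ψ 0 = 0 := by simp [hΨ]
  have hTexp : ∀ t, T t = T 0 * Complex.exp (Complex.I * Ψ t) := by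
    intro t
    have hd : ∀ t, HasDerivAt (fun t => T t * Complex.exp (-(Complex.I * Ψ t))) 0 t := by
      intro t
      refine ((hT t).mul ((hΨ' t).const_mul Complex.I).neg.cexp).congr_deriv ?_
      ring
    have hc := is_const_of_deriv_eq_zero (fun t => (hd t).differentiableAt)
      (fun t => (hd t).deriv) t 0
    simp only [hΨ0, mul_zero, neg_zero, Complex.exp_zero, mul_one] at hc
    rw [← hc, mul_assoc, ← Complex.exp_add]
    simp
  have hre : ∀ t, HasDerivAt (fun t => (Ψ t).re) (p t).re t := fun t =>
    Complex.reCLM.hasFDerivAt.comp_hasDerivAt t (hΨ' t)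
  have hmono : StrictMono fun t => (Ψ t).re :=
    strictMono_of_deriv_pos fun t => by rw [(hre t).deriv]; exact hpos t
  have hcont : Continuous fun t => (Ψ t).re :=
    continuous_iff_continuousAt.2 fun t => (hre t).continuousAt
  have hΨ2 : (Ψ (2 * Real.pi)).re = 2 * Real.pi := by
    rw [hΨ]
    simp only [hint]
    simp
  have hpi := Real.pi_pos
  obtain ⟨a, ha, hΨa⟩ : ∃ a ∈ Icc 0 (2 * Real.pi), (Ψ a).re = Real.pi := by
    apply intermediate_value_Icc (by positivity) hcont.continuousOn
    rw [hΨ2, hΨ0, Complex.zero_re]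
    constructor <;> linarith
  set h : ℝ → ℝ := fun t => ((e t - e 0) / T 0).re with hh
  have hd : ∀ t, HasDerivAt h (-(Real.exp (-(Ψ t).im) * Real.sin (Ψ t).re)) t := by
    intro t
    have h1 := Complex.reCLM.hasFDerivAt.comp_hasDerivAt t (((he t).sub_const (e 0)).div_const (T 0))
    refine h1.congr_deriv ?_
    rw [hTexp t]
    have : Complex.I * (T 0 * Complex.exp (Complex.I * Ψ t)) / T 0 =
        Complex.I * Complex.exp (Complex.I * Ψ t) := by
      field_simp
    rw [this]
    simp [Complex.exp_re, Complex.exp_im]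
  have hhc : Continuous h := continuous_iff_continuousAt.2 fun t => (hd t).continuousAt
  have h0 : h 0 = 0 := by simp [hh]
  have h2 : h (2 * Real.pi) = 0 := by simp [hh, hper]
  have hanti : StrictAntiOn h (Icc 0 a) := by
    refine strictAntiOn_of_deriv_neg (convex_Icc _ _) hhc.continuousOn fun s hs => ?_
    rw [interior_Icc] at hs
    rw [(hd s).deriv, neg_lt_zero]
    refine mul_pos (Real.exp_pos _) (Real.sin_pos_of_pos_of_lt_pi ?_ ?_)
    · simpa [hΨ0] using hmono hs.1
    · rw [← hΨa]
      exact hmono hs.2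
  have hmon : StrictMonoOn h (Icc a (2 * Real.pi)) := by
    refine strictMonoOn_of_deriv_pos (convex_Icc _ _) hhc.continuousOn fun s hs => ?_
    rw [interior_Icc] at hs
    rw [(hd s).deriv, ← mul_neg, ← Real.sin_sub_pi]
    refine mul_pos (Real.exp_pos _) (Real.sin_pos_of_pos_of_lt_pi ?_ ?_)
    · rw [← hΨa, sub_pos]
      exact hmono hs.1
    · have := hmono hs.2
      simp only [hΨ2] at this
      linarith
  rcases le_total t a with hta | hta
  · have := hanti (left_mem_Icc.2 ha.1) ⟨ht.1.le, hta⟩ ht.1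
    rwa [h0] at this
  · have := hmon ⟨hta, ht.2.le⟩ (right_mem_Icc.2 ha.2) ht.2
    rwa [h2] at this

namespace IsConvexFunction

variable {q : ℂ → ℂ}

lemma map_nhds (hq : IsConvexFunction q) {z : ℂ} (hz : z ∈ unitDisk) :
    map q (𝓝 z) = 𝓝 (q z) :=
  (hq.1.analyticAt (isOpen_unitDisk.mem_nhds hz)).hasStrictDerivAt.map_nhds_eq (hq.2 z hz).1

lemma re_neg_on_circle (hq : IsConvexFunction q) {ζ : ℂ} (hζ : ζ ∈ unitDisk) (hζ0 : ζ ≠ 0) {t : ℝ}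
    (ht : t ∈ Ioo 0 (2 * Real.pi)) :
    ((q (ζ * Complex.exp (t * Complex.I)) - q ζ) / (ζ * deriv q ζ)).re < 0 := by
  set c : ℝ → ℂ := fun t => ζ * Complex.exp (t * Complex.I) with hc
  have hcD : ∀ t, c t ∈ unitDisk := fun t => by
    rw [mem_unitDisk, hc, norm_mul, Complex.norm_exp_ofReal_mul_I, mul_one]
    exact mem_unitDisk.1 hζ
  have hc' : ∀ t, HasDerivAt c (Complex.I * c t) t := by
    intro t
    have h1 : HasDerivAt (fun t : ℝ => (t : ℂ) * Complex.I) Complex.I t := by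
      simpa using (Complex.ofRealCLM.hasDerivAt (x := t)).mul_const Complex.I
    refine (h1.cexp.const_mul ζ).congr_deriv ?_
    simp only [hc]
    ring
  have hcc : Continuous c := continuous_iff_continuousAt.2 fun t => (hc' t).continuousAt
  have hq1 := hq.1.deriv isOpen_unitDisk
  have hq2 := hq1.deriv isOpen_unitDisk
  set P : ℂ → ℂ := fun z => 1 + z * deriv (deriv q) z / deriv q z with hP
  have hPd : DifferentiableOn ℂ P unitDisk :=
    ((differentiableOn_id.mul hq2).div hq1 fun z hz => (hq.2 z hz).1).const_add 1
  have hc0 : c 0 = ζ := by simp [hc]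
  have key := re_neg_of_turning (e := fun t => q (c t)) (T := fun t => c t * deriv q (c t))
    (p := fun t => P (c t)) (t := t)
    (fun t => ((hasDerivAt_deriv hq.1 (hcD t)).comp t (hc' t)).congr_deriv (by ring))
    (fun t => by
      refine ((hc' t).mul ((hasDerivAt_deriv hq1 (hcD t)).comp t (hc' t))).congr_deriv ?_
      have := (hq.2 _ (hcD t)).1
      simp only [hP, Function.comp_apply]
      field_simp)
    (hPd.continuousOn.comp_continuous hcc hcD) (fun t => (hq.2 _ (hcD t)).2)
    (by
      have hd : DifferentiableOn ℂ (fun z => P (ζ * z)) (closedBall 0 |1|) := by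
        refine hPd.comp (differentiableOn_id.const_mul ζ) fun z hz => ?_
        rw [abs_one, mem_closedBall_zero_iff] at hz
        rw [mem_unitDisk, norm_mul]
        exact (mul_le_of_le_one_right (norm_nonneg _) hz).trans_lt (mem_unitDisk.1 hζ)
      have hav := (hd.diffContOnCl_ball subset_rfl).circleAverage
      rw [Real.circleAverage_def, Complex.real_smul] at hav
      simp only [circleMap_zero, Complex.ofReal_one, one_mul] at hav
      rw [mul_zero, show P 0 = 1 by simp [hP]] at hav
      have hpi : (2 * Real.pi : ℂ) ≠ 0 := by simp [Real.pi_ne_zero]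
      push_cast at hav
      rwa [inv_mul_eq_one₀ hpi, eq_comm] at hav)
    (by simpa [hc0] using ⟨hζ0, (hq.2 ζ hζ).1⟩) (by simp [hc]) ht
  simpa only [hc0] using key

/-- The image of the disk `|z| ≤ |ζ|` under a convex function lies in the half-plane that is
tangent at `q(ζ)` and has outer normal `ζ q'(ζ)`. -/
lemma re_neg (hq : IsConvexFunction q) {z ζ : ℂ} (hζ : ζ ∈ unitDisk) (hz : ‖z‖ ≤ ‖ζ‖)
    (hne : z ≠ ζ) : ((q z - q ζ) / (ζ * deriv q ζ)).re < 0 := by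
  have hζ0 : ζ ≠ 0 := by
    rintro rfl
    exact hne (by simpa using hz)
  have hT : ζ * deriv q ζ ≠ 0 := mul_ne_zero hζ0 (hq.2 ζ hζ).1
  have hsphere : ∀ z : ℂ, ‖z‖ = ‖ζ‖ → z ≠ ζ → ((q z - q ζ) / (ζ * deriv q ζ)).re < 0 := by
    intro z hz hne
    have hn : ‖z / ζ‖ = 1 := by
      rw [norm_div, hz, div_self (norm_ne_zero_iff.2 hζ0)]
    have hz' : z = ζ * Complex.exp (Complex.arg (z / ζ) * Complex.I) := by
      have := Complex.norm_mul_exp_arg_mul_I (z / ζ)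
      rw [hn, Complex.ofReal_one, one_mul] at this
      rw [this]
      field_simp
    have hpi := Real.pi_pos
    have h1 := Complex.neg_pi_lt_arg (z / ζ)
    have h2 := Complex.arg_le_pi (z / ζ)
    rcases lt_trichotomy (Complex.arg (z / ζ)) 0 with h | h | h
    · have := hq.re_neg_on_circle hζ hζ0 (t := Complex.arg (z / ζ) + 2 * Real.pi)
        ⟨by linarith, by linarith⟩
      push_cast at this
      rwa [add_mul, Complex.exp_add, Complex.exp_two_pi_mul_I, mul_one, ← hz'] at this
    · rw [h] at hz'
      exact absurd (by simpa using hz') hne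
    · have := hq.re_neg_on_circle hζ hζ0 (t := Complex.arg (z / ζ)) ⟨h, by linarith⟩
      rwa [← hz'] at this
  rcases hz.lt_or_eq with hz | hz
  swap
  · exact hsphere z hz hne
  have hζ1 := mem_unitDisk.1 hζ
  have hle : ∀ w ∈ ball (0 : ℂ) ‖ζ‖, ((q w - q ζ) / (ζ * deriv q ζ)).re ≤ 0 := by
    intro w hw
    have hd : DifferentiableOn ℂ (fun w => Complex.exp ((q w - q ζ) / (ζ * deriv q ζ))) unitDisk :=
      ((hq.1.sub_const _).div_const _).cexp
    have := Complex.norm_le_of_forall_mem_frontier_norm_le (isBounded_ball (x := (0 : ℂ)) (r := ‖ζ‖))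
      (hd.diffContOnCl_ball (closedBall_subset_ball hζ1)) (C := 1) (fun w hw => by
        rw [frontier_ball _ (norm_ne_zero_iff.2 hζ0), mem_sphere_zero_iff_norm] at hw
        rw [Complex.norm_exp, Real.exp_le_one_iff]
        by_cases hwζ : w = ζ
        · simp [hwζ]
        · exact (hsphere w hw hwζ).le) (subset_closure hw)
    rwa [Complex.norm_exp, Real.exp_le_one_iff] at this
  -- The bound is strict because `q` is open at `z`: it can be moved in the direction `ζ q'(ζ)`.
  have hnhds : ∀ᶠ u in 𝓝 (q z), ((u - q ζ) / (ζ * deriv q ζ)).re ≤ 0 := by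
    rw [← hq.map_nhds (mem_unitDisk.2 (hz.trans hζ1)), eventually_map]
    filter_upwards [isOpen_ball.mem_nhds (mem_ball_zero_iff.2 hz)] with w hw using hle w hw
  have hlim : Tendsto (fun t : ℝ => q z + t * (ζ * deriv q ζ)) (𝓝[>] 0) (𝓝 (q z)) := by
    have : Continuous fun t : ℝ => q z + t * (ζ * deriv q ζ) := by fun_prop
    simpa using (this.tendsto 0).mono_left nhdsWithin_le_nhds
  obtain ⟨t, ht, ht0⟩ := ((hlim.eventually hnhds).and self_mem_nhdsWithin).exists
  have ht0 : 0 < t := ht0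
  have : (q z + t * (ζ * deriv q ζ) - q ζ) / (ζ * deriv q ζ) =
      (q z - q ζ) / (ζ * deriv q ζ) + (t : ℂ) := by
    rw [add_sub_right_comm, add_div, mul_div_cancel_right₀ _ hT]
  rw [this, Complex.add_re, Complex.ofReal_re] at ht
  linarith

lemma injOn (hq : IsConvexFunction q) : InjOn q unitDisk := by
  intro z hz ζ hζ h
  by_contra hne
  rcases le_total ‖z‖ ‖ζ‖ with hle | hle
  · simpa [h] using hq.re_neg hζ hle hne
  · simpa [h] using hq.re_neg hz hle (Ne.symm hne)

lemma isOpen_image (hq : IsConvexFunction q) {U : Set ℂ} (hU : IsOpen U) (hsub : U ⊆ unitDisk) :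
    IsOpen (q '' U) := by
  rw [isOpen_iff_mem_nhds]
  rintro _ ⟨z, hz, rfl⟩
  rw [← hq.map_nhds (hsub hz)]
  exact image_mem_map (hU.mem_nhds hz)

/-- A segment between two points of the open set `q(|z| < r)` cannot touch its boundary, as the
tangent half-plane at a boundary point contains both end points in its interior. -/
lemma convex_image_ball (hq : IsConvexFunction q) {r : ℝ} (hr : r < 1) :
    Convex ℝ (q '' ball 0 r) := by
  have hsub : ball (0 : ℂ) r ⊆ unitDisk := ball_subset_ball hr.le
  have hsub' : closedBall (0 : ℂ) r ⊆ unitDisk := closedBall_subset_ball hr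
  have hcl : closure (q '' ball 0 r) ⊆ q '' closedBall 0 r :=
    closure_minimal (image_mono ball_subset_closedBall)
      ((isCompact_closedBall _ _).image_of_continuousOn (hq.1.continuousOn.mono hsub')).isClosed
  rw [convex_iff_segment_subset]
  rintro _ ⟨a, ha, rfl⟩ _ ⟨b, hb, rfl⟩
  refine (convex_segment _ _).isPreconnected.subset_of_closure_inter_subset
    (hq.isOpen_image isOpen_ball hsub) ⟨q a, left_mem_segment _ _ _, mem_image_of_mem q ha⟩ ?_
  rintro _ ⟨hsc, hseg⟩
  obtain ⟨ζ, hζ, rfl⟩ := hcl hsc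
  by_cases hlt : ‖ζ‖ < r
  · exact mem_image_of_mem q (mem_ball_zero_iff.2 hlt)
  exfalso
  have hζD := hsub' hζ
  have hside : ∀ c ∈ ball (0 : ℂ) r, ((q c - q ζ) / (ζ * deriv q ζ)).re < 0 := by
    intro c hc
    have hc' := (mem_ball_zero_iff.1 hc).trans_le (not_lt.1 hlt)
    exact hq.re_neg hζD hc'.le (by rintro rfl; exact lt_irrefl _ hc')
  obtain ⟨s, t, hs, ht, hst, hsum⟩ := hseg
  have hzero : (s : ℂ) * ((q a - q ζ) / (ζ * deriv q ζ)) +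
      (t : ℂ) * ((q b - q ζ) / (ζ * deriv q ζ)) = 0 := by
    have hst' : (s : ℂ) + t = 1 := by exact_mod_cast hst
    simp only [Complex.real_smul] at hsum
    rw [mul_div_assoc', mul_div_assoc', ← add_div]
    have : (s : ℂ) * (q a - q ζ) + t * (q b - q ζ) = 0 := by
      linear_combination hsum - q ζ * hst'
    rw [this, zero_div]
  have hre := congrArg Complex.re hzero
  simp only [Complex.add_re, Complex.re_ofReal_mul, Complex.zero_re] at hre
  have ha' := hside a ha
  have hb' := hside b hb
  rcases hs.lt_or_eq with hs | hs
  · nlinarith [mul_neg_of_pos_of_neg hs ha', mul_nonpos_of_nonneg_of_nonpos ht hb'.le]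
  · have : t = 1 := by linarith
    subst this
    nlinarith

lemma convex_image (hq : IsConvexFunction q) : Convex ℝ (q '' unitDisk) := by
  rw [convex_iff_segment_subset]
  rintro _ ⟨a, ha, rfl⟩ _ ⟨b, hb, rfl⟩
  obtain ⟨r, hr, hr1⟩ := exists_between (max_lt (mem_unitDisk.1 ha) (mem_unitDisk.1 hb))
  have ha' : a ∈ ball (0 : ℂ) r := mem_ball_zero_iff.2 ((le_max_left _ _).trans_lt hr)
  have hb' : b ∈ ball (0 : ℂ) r := mem_ball_zero_iff.2 ((le_max_right _ _).trans_lt hr)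
  exact ((hq.convex_image_ball hr1).segment_subset (mem_image_of_mem q ha')
    (mem_image_of_mem q hb')).trans (image_mono (ball_subset_ball hr1.le))

lemma exists_inverse (hq : IsConvexFunction q) :
    ∃ g : ℂ → ℂ, ∀ z ∈ unitDisk, g (q z) = z ∧ HasDerivAt g (deriv q z)⁻¹ (q z) := by
  have hinv : LeftInvOn (Function.invFunOn q unitDisk) q unitDisk := hq.injOn.leftInvOn_invFunOn
  refine ⟨Function.invFunOn q unitDisk, fun z hz => ⟨hinv hz, ?_⟩⟩
  have hev : ∀ᶠ w in 𝓝 z, Function.invFunOn q unitDisk (q w) = w := by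
    filter_upwards [isOpen_unitDisk.mem_nhds hz] with w hw using hinv hw
  refine HasDerivAt.of_local_left_inverse (f := q) ?_ ?_ (hq.2 z hz).1 ?_
  · rw [ContinuousAt, hinv hz, ← hq.map_nhds hz, tendsto_map'_iff]
    exact tendsto_id.congr' (hev.mono fun w hw => hw.symm)
  · rw [hinv hz]
    exact hasDerivAt_deriv hq.1 hz
  · rw [← hq.map_nhds hz, eventually_map]
    exact hev.mono fun w hw => by rw [hw]

/-- The mean value inequality on the convex image of `q`: if `Re (Φ' / q') > 0`, then the difference
quotients of `Φ` with respect to `q` have positive real part too. -/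
lemma re_div_sub_pos (hq : IsConvexFunction q) {Φ : ℂ → ℂ} (hΦ : DifferentiableOn ℂ Φ unitDisk)
    (hpos : ∀ z ∈ unitDisk, 0 < (deriv Φ z / deriv q z).re) {z ζ : ℂ} (hz : z ∈ unitDisk)
    (hζ : ζ ∈ unitDisk) (hne : z ≠ ζ) : 0 < ((Φ z - Φ ζ) / (q z - q ζ)).re := by
  have hΔ : q z - q ζ ≠ 0 := sub_ne_zero.2 fun h => hne (hq.injOn hz hζ h)
  obtain ⟨g, hg⟩ := hq.exists_inverse
  set s : ℝ → ℂ := fun t => q ζ + t * (q z - q ζ) with hs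
  have hs' : ∀ t, HasDerivAt s (q z - q ζ) t := by
    intro t
    simpa [hs] using ((Complex.ofRealCLM.hasDerivAt (x := t)).mul_const (q z - q ζ)).const_add (q ζ)
  set u : ℝ → ℝ := fun t => (Φ (g (s t)) / (q z - q ζ)).re with hu
  have hu' : ∀ t ∈ Icc (0 : ℝ) 1, ∃ d > 0, HasDerivAt u d t := by
    intro t ht
    obtain ⟨w, hw, hws⟩ : s t ∈ q '' unitDisk := by
      refine hq.convex_image.segment_subset (mem_image_of_mem q hζ) (mem_image_of_mem q hz) ?_
      rw [segment_eq_image']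
      exact ⟨t, ht, by simp [hs]⟩
    obtain ⟨h1, h2⟩ := hg w hw
    refine ⟨_, hpos w hw, ?_⟩
    rw [hws] at h1 h2
    have h3 : HasDerivAt Φ (deriv Φ w) (g (s t)) := by
      rw [h1]
      exact hasDerivAt_deriv hΦ hw
    refine (Complex.reCLM.hasFDerivAt.comp_hasDerivAt t
      (((h3.comp _ h2).comp t (hs' t)).div_const (q z - q ζ))).congr_deriv ?_
    simp only [Complex.reCLM_apply]
    congr 1
    field_simp
  have hmono : StrictMonoOn u (Icc 0 1) := by
    refine strictMonoOn_of_deriv_pos (convex_Icc _ _)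
      (fun t ht => (hu' t ht).choose_spec.2.continuousAt.continuousWithinAt) fun t ht => ?_
    obtain ⟨d, hd, hd'⟩ := hu' t (interior_subset ht)
    rwa [hd'.deriv]
  have := hmono (left_mem_Icc.2 zero_le_one) (right_mem_Icc.2 zero_le_one) zero_lt_one
  simp only [hu, hs, Complex.ofReal_zero, zero_mul, add_zero, Complex.ofReal_one, one_mul,
    add_sub_cancel, (hg z hz).1, (hg ζ hζ).1] at this
  rw [sub_div, Complex.sub_re]
  linarith

/-- A function that is close-to-convex with respect to `q` is linearly accessible: the ray that
leaves `Φ(ζ)` in the direction of the outer normal `ζ q'(ζ)` does not meet `Φ(|z| ≤ |ζ|)` again. -/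
lemma ne_add_mul_normal (hq : IsConvexFunction q) {Φ : ℂ → ℂ} (hΦ : DifferentiableOn ℂ Φ unitDisk)
    (hpos : ∀ z ∈ unitDisk, 0 < (deriv Φ z / deriv q z).re) {z ζ : ℂ} (hζ : ζ ∈ unitDisk)
    (hz : ‖z‖ ≤ ‖ζ‖) (hne : z ≠ ζ) {t : ℝ} (ht : 0 ≤ t) : Φ z ≠ Φ ζ + t * (ζ * deriv q ζ) := by
  intro h
  have hzD : z ∈ unitDisk := mem_unitDisk.2 (hz.trans_lt (mem_unitDisk.1 hζ))
  have hΔ : q z - q ζ ≠ 0 := sub_ne_zero.2 fun h => hne (hq.injOn hzD hζ h)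
  have h1 := hq.re_div_sub_pos hΦ hpos hzD hζ hne
  have h2 := hq.re_neg hζ hz hne
  set c := (Φ z - Φ ζ) / (q z - q ζ) with hc
  set X := (q z - q ζ) / (ζ * deriv q ζ) with hX
  have hT : ζ * deriv q ζ ≠ 0 := by
    intro h0
    simp [hX, h0] at h2
  have hc0 : c ≠ 0 := by
    intro h0
    simp [h0] at h1
  have hXc : X = t * c⁻¹ := by
    rw [eq_mul_inv_iff_mul_eq₀ hc0, hX, hc, h, add_sub_cancel_left, div_mul_div_cancel₀' hΔ,
      mul_div_cancel_right₀ _ hT]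
  rw [hXc, Complex.re_ofReal_mul, Complex.inv_re] at h2
  have : 0 ≤ t * (c.re / Complex.normSq c) :=
    mul_nonneg ht (div_nonneg h1.le (Complex.normSq_nonneg c))
  linarith

end IsConvexFunction

/-! ### The differential subordination -/

namespace IsConvexFunction

variable {q Φ : ℂ → ℂ} {α : ℝ}

lemma differentiableOn_add_mul_deriv (hq : IsConvexFunction q)
    (hΦ : ∀ z ∈ unitDisk, Φ z = q z + α * (z * deriv q z)) : DifferentiableOn ℂ Φ unitDisk :=
  (hq.1.add ((differentiableOn_id.mul (hq.1.deriv isOpen_unitDisk)).const_mul (α : ℂ))).congr hΦ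

/-- `q + α z q'` is close-to-convex with respect to `q`. -/
lemma re_deriv_div_deriv_pos (hq : IsConvexFunction q) (hα : 0 < α)
    (hΦ : ∀ z ∈ unitDisk, Φ z = q z + α * (z * deriv q z)) {z : ℂ} (hz : z ∈ unitDisk) :
    0 < (deriv Φ z / deriv q z).re := by
  obtain ⟨h0, hP⟩ := hq.2 z hz
  have : deriv Φ z / deriv q z = 1 + α * (1 + z * deriv (deriv q) z / deriv q z) := by
    rw [deriv_add_mul_deriv hq.1 hΦ hz]
    field_simp
    ring
  rw [this, Complex.add_re, Complex.re_ofReal_mul, Complex.one_re]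
  positivity

lemma univalent_add_mul_deriv (hq : IsConvexFunction q) (hα : 0 < α)
    (hΦ : ∀ z ∈ unitDisk, Φ z = q z + α * (z * deriv q z)) : Univalent Φ := by
  have hd := hq.differentiableOn_add_mul_deriv hΦ
  refine ⟨hd, fun z hz ζ hζ h => ?_⟩
  by_contra hne
  have := hq.re_div_sub_pos hd (fun z hz => hq.re_deriv_div_deriv_pos hα hΦ hz) hz hζ hne
  rw [h, sub_self, zero_div, Complex.zero_re] at this
  exact lt_irrefl _ this

/-- The **differential subordination** `ρ + α z ρ' ≺ q + α z q'` implies `ρ ≺ q`. Let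
`w = q⁻¹ ∘ ρ`. If `|w(z)| > |z|` somewhere, then at a maximum point `z₀` of `|w|` Jack's lemma gives
`z₀ ρ'(z₀) = m w₀ q'(w₀)` with `w₀ = w(z₀)` and `m ≥ 1`, so that `ρ + α z ρ'` takes at `z₀` a value
on the ray from `Φ(w₀)` in the direction of `w₀ q'(w₀)`, which is not in `Φ(|z| < |w₀|)`. -/
lemma subordinate_of_add_mul_deriv (hq : IsConvexFunction q) (hα : 0 < α)
    (hΦ : ∀ z ∈ unitDisk, Φ z = q z + α * (z * deriv q z)) {ρ : ℂ → ℂ}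
    (hρ : DifferentiableOn ℂ ρ unitDisk)
    (hsub : Subordinate (fun z => ρ z + α * (z * deriv ρ z)) Φ) : Subordinate ρ q := by
  obtain ⟨ω, -, hω⟩ := hsub
  obtain ⟨g, hg⟩ := hq.exists_inverse
  have h0D : (0 : ℂ) ∈ unitDisk := by simp [unitDisk]
  have hρ0 : ρ 0 = q 0 := by
    obtain ⟨h1, h2⟩ := hω 0 h0D
    rw [norm_zero, norm_le_zero_iff] at h1
    simpa [h1, hΦ 0 h0D] using h2
  have hw : ∀ z ∈ unitDisk, ρ z ∈ q '' unitDisk → g (ρ z) ∈ unitDisk ∧ q (g (ρ z)) = ρ z ∧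
      HasDerivAt (fun z => g (ρ z)) ((deriv q (g (ρ z)))⁻¹ * deriv ρ z) z := by
    rintro z hz ⟨ζ, hζ, h⟩
    obtain ⟨h1, h2⟩ := hg ζ hζ
    rw [h] at h1 h2
    rw [h1]
    exact ⟨hζ, h, h2.comp z (hasDerivAt_deriv hρ hz)⟩
  -- On any disk that `ρ` maps into `q(𝔻)`, Jack's lemma bounds `w = g ∘ ρ` by `|z|`.
  have hbound : ∀ r ≤ (1 : ℝ), (∀ z ∈ ball (0 : ℂ) r, ρ z ∈ q '' unitDisk) →
      ∀ z ∈ ball (0 : ℂ) r, ‖g (ρ z)‖ ≤ ‖z‖ := by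
    intro r hr hmaps z₁ hz₁
    by_contra! hlt
    have hrD : ball (0 : ℂ) r ⊆ unitDisk := ball_subset_ball hr
    have hw' := fun z hz => hw z (hrD hz) (hmaps z hz)
    have hsub : closedBall (0 : ℂ) ‖z₁‖ ⊆ ball 0 r :=
      closedBall_subset_ball (mem_ball_zero_iff.1 hz₁)
    obtain ⟨z₀, hz₀, hmax⟩ := (isCompact_closedBall (0 : ℂ) ‖z₁‖).exists_isMaxOn
      (f := fun z => ‖g (ρ z)‖) ⟨z₁, by simp⟩
      fun z hz => (hw' z (hsub hz)).2.2.continuousAt.norm.continuousWithinAt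
    have hz₀1 := mem_closedBall_zero_iff.1 hz₀
    obtain ⟨hw₀D, hqw, hwd⟩ := hw' z₀ (hsub hz₀)
    have hlt₀ : ‖z₀‖ < ‖g (ρ z₀)‖ :=
      hz₀1.trans_lt (hlt.trans_le (hmax (show z₁ ∈ closedBall 0 ‖z₁‖ by simp)))
    obtain ⟨m, hm, hJ⟩ := exists_real_mul_of_isMaxOn (V := fun z => g (ρ z)) (z₀ := z₀)
      (fun z hz => (hw' z (hsub (ball_subset_closedBall.trans
        (closedBall_subset_closedBall hz₀1) hz))).2.2.differentiableAt.differentiableWithinAt)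
      hwd.differentiableAt (by simp only [hρ0, (hg 0 h0D).1])
      (norm_pos_iff.1 ((norm_nonneg _).trans_lt hlt₀))
      (fun z hz => hmax (closedBall_subset_closedBall hz₀1 hz))
    rw [hwd.deriv] at hJ
    have hq' := (hq.2 _ hw₀D).1
    obtain ⟨hω1, hω2⟩ := hω z₀ (hrD (hsub hz₀))
    have hωlt : ‖ω z₀‖ < ‖g (ρ z₀)‖ := hω1.trans_lt hlt₀
    refine hq.ne_add_mul_normal (hq.differentiableOn_add_mul_deriv hΦ)
      (fun z hz => hq.re_deriv_div_deriv_pos hα hΦ hz) hw₀D hωlt.le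
      (fun h => by rw [h] at hωlt; exact lt_irrefl _ hωlt) (t := α * (m - 1))
      (mul_nonneg hα.le (by linarith)) ?_
    rw [← hω2, hΦ _ hw₀D, hqw]
    have hρ' : z₀ * deriv ρ z₀ = m * (g (ρ z₀) * deriv q (g (ρ z₀))) := by
      field_simp at hJ
      linear_combination hJ
    simp only [hρ']
    push_cast
    ring
  -- At a point `z₀` of least modulus with `ρ(z₀) ∉ q(𝔻)`, the bound `|w(z)| ≤ |z|` for `|z| < |z₀|`
  -- keeps `ρ(z)` in the compact set `q(|z| ≤ |z₀|)`, and hence `ρ(z₀)` as well.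
  have hall : ∀ z ∈ unitDisk, ρ z ∈ q '' unitDisk := by
    by_contra! hex
    obtain ⟨z₁, hz₁, hbad⟩ := hex
    have hsub : closedBall (0 : ℂ) ‖z₁‖ ⊆ unitDisk := closedBall_subset_ball (mem_unitDisk.1 hz₁)
    have hK : IsCompact (closedBall (0 : ℂ) ‖z₁‖ ∩ ρ ⁻¹' (q '' unitDisk)ᶜ) :=
      (isCompact_closedBall _ _).of_isClosed_subset
        ((hρ.continuousOn.mono hsub).preimage_isClosed_of_isClosed isClosed_closedBall
          (hq.isOpen_image isOpen_unitDisk subset_rfl).isClosed_compl) inter_subset_left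
    obtain ⟨z₀, ⟨hz₀, hbad₀⟩, hmin⟩ := hK.exists_isMinOn ⟨z₁, by simp, hbad⟩
      continuous_norm.continuousOn
    have hz₀1 := mem_unitDisk.1 (hsub hz₀)
    have hmaps : ∀ z ∈ ball (0 : ℂ) ‖z₀‖, ρ z ∈ q '' unitDisk := by
      intro z hz
      by_contra hcon
      have hzn := mem_ball_zero_iff.1 hz
      have := hmin ⟨mem_closedBall_zero_iff.2 (hzn.le.trans (mem_closedBall_zero_iff.1 hz₀)), hcon⟩
      exact absurd hzn (not_lt.2 this)
    have hz₀0 : z₀ ≠ 0 := by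
      rintro rfl
      exact hbad₀ (by rw [hρ0]; exact mem_image_of_mem q h0D)
    have hcl : IsClosed (q '' closedBall 0 ‖z₀‖) :=
      ((isCompact_closedBall _ _).image_of_continuousOn
        (hq.1.continuousOn.mono (closedBall_subset_ball hz₀1))).isClosed
    have hmem : ρ z₀ ∈ closure (q '' closedBall 0 ‖z₀‖) := by
      have hc : ContinuousWithinAt ρ (ball 0 ‖z₀‖) z₀ :=
        (hasDerivAt_deriv hρ (hsub hz₀)).continuousAt.continuousWithinAt
      refine hc.mem_closure (by rw [closure_ball _ (norm_ne_zero_iff.2 hz₀0)]; simp) fun z hz => ?_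
      have hzD : z ∈ unitDisk := ball_subset_ball hz₀1.le hz
      refine ⟨g (ρ z), mem_closedBall_zero_iff.2 ?_, (hw z hzD (hmaps z hz)).2.1⟩
      exact (hbound _ hz₀1.le hmaps z hz).trans (mem_ball_zero_iff.1 hz).le
    rw [hcl.closure_eq] at hmem
    exact hbad₀ (image_mono (closedBall_subset_ball hz₀1) hmem)
  exact ⟨fun z => g (ρ z),
    fun z hz => (hw z hz (hall z hz)).2.2.differentiableAt.differentiableWithinAt,
    fun z hz => ⟨hbound 1 le_rfl hall z hz, (hw z hz (hall z hz)).2.1.symm⟩⟩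

end IsConvexFunction

/-! ### Power series and the recurrence for the Bessel coefficients -/

lemma powerSeries_on_unitDisk {b : ℕ → ℂ} {q : ℂ → ℂ}
    (hb : ∀ r : ℝ, 0 < r → r < 1 → Summable fun n => ‖b n‖ * r ^ n)
    (hq : ∀ z, q z = ∑' n, b n * z ^ n) :
    DifferentiableOn ℂ q unitDisk ∧ ∀ z ∈ unitDisk, HasSum (fun n => b n * z ^ n) (q z) ∧
      HasSum (fun n => n * (b n * z ^ n)) (z * deriv q z) := by
  obtain rfl : q = fun z => ∑' n, b n * z ^ n := funext hq
  have hd : ∀ n, Differentiable ℂ fun z : ℂ => b n * z ^ n := fun n => by fun_prop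
  have hle : ∀ r : ℝ, ∀ n, ∀ w ∈ ball (0 : ℂ) r, ‖b n * w ^ n‖ ≤ ‖b n‖ * r ^ n := by
    intro r n w hw
    rw [norm_mul, norm_pow]
    gcongr
    exact (mem_ball_zero_iff.1 hw).le
  have hr : ∀ z ∈ unitDisk, ∃ r : ℝ, 0 < r ∧ r < 1 ∧ z ∈ ball (0 : ℂ) r := by
    intro z hz
    obtain ⟨r, h1, h2⟩ := exists_between (mem_unitDisk.1 hz)
    exact ⟨r, (norm_nonneg _).trans_lt h1, h2, mem_ball_zero_iff.2 h1⟩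
  constructor
  · intro z hz
    obtain ⟨r, h0, h1, hzr⟩ := hr z hz
    exact ((Complex.differentiableOn_tsum_of_summable_norm (hb r h0 h1)
      (fun n => (hd n).differentiableOn) isOpen_ball (hle r)).differentiableAt
      (isOpen_ball.mem_nhds hzr)).differentiableWithinAt
  · intro z hz
    obtain ⟨r, h0, h1, hzr⟩ := hr z hz
    refine ⟨(Summable.of_norm_bounded (hb r h0 h1) fun n => hle r n z hzr).hasSum, ?_⟩
    refine ((Complex.hasSum_deriv_of_summable_norm (hb r h0 h1)
      (fun n => (hd n).differentiableOn) isOpen_ball (hle r) hzr).mul_left z).congr_fun fun n => ?_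
    rcases n with _ | n
    · simp
    · simp
      ring

lemma one_le_norm_ascPochhammer {ν : ℝ} (hν : 0 < ν) (n : ℕ) :
    1 ≤ ‖(ascPochhammer ℂ n).eval ((ν : ℂ) + 1)‖ := by
  induction n with
  | zero => simp
  | succ n ih =>
    rw [ascPochhammer_succ_eval, norm_mul]
    refine one_le_mul_of_one_le_of_one_le ih ?_
    have : (ν : ℂ) + 1 + n = ((ν + 1 + n : ℝ) : ℂ) := by push_cast; ring
    rw [this, Complex.norm_real, Real.norm_of_nonneg (by positivity)]
    have : (0 : ℝ) ≤ n := n.cast_nonneg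
    linarith

lemma norm_besselCoeff_le {ν : ℝ} (hν : 0 < ν) (c : ℂ) (n : ℕ) :
    ‖besselCoeff ((ν : ℂ) + 1) c n‖ ≤ Real.exp ‖-c / 4‖ := by
  refine le_trans ?_ (Real.pow_div_factorial_le_exp _ (norm_nonneg (-c / 4)) n)
  rw [besselCoeff, norm_div, norm_mul, norm_pow, Complex.norm_natCast]
  gcongr
  exact le_mul_of_one_le_left (by positivity) (one_le_norm_ascPochhammer hν n)

/-- The recurrence `1 / (ν)_n = (1 + n / ν) / (ν + 1)_n`, on the level of power series
`B_ν(f) / z = u + z u' / ν` with `u = B_{ν+1}(f) / z`. -/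
lemma besselCoeff_eq_mul {ν : ℝ} (hν : 0 < ν) (c : ℂ) (n : ℕ) :
    besselCoeff (ν : ℂ) c n = besselCoeff ((ν : ℂ) + 1) c n * (1 + n / ν) := by
  have hν0 : (ν : ℂ) ≠ 0 := Complex.ofReal_ne_zero.2 hν.ne'
  have h1 : (ascPochhammer ℂ n).eval ((ν : ℂ) + 1) ≠ 0 :=
    norm_pos_iff.1 (zero_lt_one.trans_le (one_le_norm_ascPochhammer hν n))
  have h2 : (ν : ℂ) + n ≠ 0 := by
    have : (ν + n : ℝ) ≠ 0 := by positivity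
    exact_mod_cast this
  have h3 : (ν : ℂ) * (ascPochhammer ℂ n).eval ((ν : ℂ) + 1) =
      (ascPochhammer ℂ n).eval (ν : ℂ) * (ν + n) := by
    rw [← ascPochhammer_succ_eval, ascPochhammer_succ_left]
    simp
  have h4 : (ascPochhammer ℂ n).eval (ν : ℂ) =
      ν * (ascPochhammer ℂ n).eval ((ν : ℂ) + 1) / (ν + n) := by
    rw [h3]
    field_simp
  have h5 : (n.factorial : ℂ) ≠ 0 := by exact_mod_cast n.factorial_ne_zero
  rw [besselCoeff, besselCoeff, h4]
  field_simp

lemma summable_taylorCoeff_succ {f : ℂ → ℂ} (hf : DifferentiableOn ℂ f unitDisk) {r : ℝ}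
    (h0 : 0 < r) (h1 : r < 1) : Summable fun n => ‖taylorCoeff f (n + 1)‖ * r ^ n := by
  have hs := (Complex.hasSum_taylorSeries_on_ball (c := 0) (r := 1) (z := (r : ℂ)) hf
    (by simpa [abs_of_pos h0] using h1)).summable.norm
  have hs' := ((summable_nat_add_iff 1).2 hs).mul_right r⁻¹
  refine hs'.congr fun n => ?_
  simp only [taylorCoeff, sub_zero, smul_eq_mul, norm_mul, norm_inv, norm_pow, norm_div,
    Complex.norm_real, Real.norm_of_nonneg h0.le]
  field_simp
  ring

/-- For `u = B_{κ+2,c}(f) / z` one has `Φ_f = u + (1 - l) / (κ + 1) z u'`. -/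
lemma besselQuot_add_mul_deriv {f : ℂ → ℂ} (hf : DifferentiableOn ℂ f unitDisk)
    (hf' : deriv f 0 = 1) {κ : ℝ} (hκ : -1 < κ) (l : ℝ) (c : ℂ) :
    DifferentiableOn ℂ (besselQuot ((κ : ℂ) + 2) c f) unitDisk ∧
      ∀ z ∈ unitDisk, besselMix l κ c f z = besselQuot ((κ : ℂ) + 2) c f z +
        (((1 - l) / (κ + 1) : ℝ) : ℂ) * (z * deriv (besselQuot ((κ : ℂ) + 2) c f) z) := by
  have hν : 0 < κ + 1 := by linarith
  have e1 : (κ : ℂ) + 1 = ((κ + 1 : ℝ) : ℂ) := by push_cast; ring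
  have e2 : (κ : ℂ) + 2 = ((κ + 1 : ℝ) : ℂ) + 1 := by push_cast; ring
  obtain ⟨hd, hs⟩ := powerSeries_on_unitDisk
    (b := fun n => taylorCoeff f (n + 1) * besselCoeff ((κ : ℂ) + 2) c n) (fun r h0 h1 => by
      refine ((summable_taylorCoeff_succ hf h0 h1).mul_right (Real.exp ‖-c / 4‖)).of_nonneg_of_le
        (fun n => by positivity) fun n => ?_
      rw [norm_mul, mul_right_comm, e2]
      gcongr
      exact norm_besselCoeff_le hν c n)
    (besselQuot_eq_tsum ((κ : ℂ) + 2) c hf')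
  refine ⟨hd, fun z hz => ?_⟩
  obtain ⟨h1, h2⟩ := hs z hz
  have h3 : besselQuot ((κ : ℂ) + 1) c f z = besselQuot ((κ : ℂ) + 2) c f z +
      ((κ + 1 : ℝ) : ℂ)⁻¹ * (z * deriv (besselQuot ((κ : ℂ) + 2) c f) z) := by
    rw [besselQuot_eq_tsum _ c hf', ← (h1.add (h2.mul_left _)).tsum_eq]
    refine tsum_congr fun n => ?_
    rw [e1, besselCoeff_eq_mul hν, ← e2]
    ring
  rw [besselMix, h3]
  push_cast
  ring

/-- With `α = (1 - l) / (κ + 1)`, the constant `γ` is at most `min(α, 1/α) / 2`, which is the infimum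
over `y` of the right-hand side: the bound that `convex_of_add_mul_deriv` requires. -/
lemma gammaConst_le {l κ : ℝ} (hl : l < 1) (hκ : -1 < κ) (y : ℝ) :
    gammaConst l κ ≤ (1 - l) / (κ + 1) * (1 + y ^ 2) /
      (2 * (1 + ((1 - l) / (κ + 1)) ^ 2 * y ^ 2)) := by
  have hA : 0 < 1 - l := by linarith
  have hB : 0 < κ + 1 := by linarith
  rw [gammaConst]
  generalize 1 - l = A at *
  generalize κ + 1 = B at *
  have e1 : A / B * (1 + y ^ 2) / (2 * (1 + (A / B) ^ 2 * y ^ 2)) =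
      A * B * (1 + y ^ 2) / (2 * (B ^ 2 + A ^ 2 * y ^ 2)) := by
    field_simp
  rw [e1, div_le_div_iff₀ (by positivity) (by positivity)]
  have hSA : A ^ 2 ≤ Real.sqrt (A ^ 4 + B ^ 4) :=
    Real.le_sqrt_of_sq_le (by nlinarith [pow_pos hB 4])
  have hSB : B ^ 2 ≤ Real.sqrt (A ^ 4 + B ^ 4) :=
    Real.le_sqrt_of_sq_le (by nlinarith [pow_pos hA 4])
  have h1 : (A ^ 2 + B ^ 2 - Real.sqrt (A ^ 4 + B ^ 4)) * B ^ 2 ≤ A ^ 2 * B ^ 2 := by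
    gcongr
    linarith
  have h2 : (A ^ 2 + B ^ 2 - Real.sqrt (A ^ 4 + B ^ 4)) * (A ^ 2 * y ^ 2) ≤
      B ^ 2 * (A ^ 2 * y ^ 2) := by
    gcongr
    linarith
  have h3 : 0 ≤ A ^ 2 * B ^ 2 * (1 + y ^ 2) := by positivity
  nlinarith

end BesselSubordination

theorem mainTheorem1 (g : ℂ → ℂ) (hg : BesselSubordination.ClassA g)
    (l : ℝ) (hl : l ∈ Set.Ico (0 : ℝ) 1) (c : ℂ) (hc : c ≠ 0)
    (p b κ : ℝ) (hκ_def : κ = p + (b + 1) / 2) (hκ : -1 < κ)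
    (Φ : ℂ → ℂ) (hΦ_def : Φ = BesselSubordination.besselMix l κ c g)
    (hΦ : ∀ z ∈ BesselSubordination.unitDisk, deriv Φ z ≠ 0 ∧
      -BesselSubordination.gammaConst l κ < (z * deriv (deriv Φ) z / deriv Φ z + 1).re) :
    (∀ f : ℂ → ℂ, BesselSubordination.ClassA f →
      BesselSubordination.Subordinate (BesselSubordination.besselMix l κ c f) Φ →
      BesselSubordination.Subordinate (BesselSubordination.besselQuot ((κ : ℂ) + 2) c f)
        (BesselSubordination.besselQuot ((κ : ℂ) + 2) c g)) ∧
    BesselSubordination.IsBestDominant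
      (fun r s => r + (((1 - l) / (κ + 1) : ℝ) : ℂ) * s) Φ
      (BesselSubordination.besselQuot ((κ : ℂ) + 2) c g) ∧
    (∀ q : ℂ → ℂ, BesselSubordination.Univalent q →
      (∀ f : ℂ → ℂ, BesselSubordination.ClassA f →
        BesselSubordination.Subordinate (BesselSubordination.besselMix l κ c f) Φ →
        BesselSubordination.Subordinate (BesselSubordination.besselQuot ((κ : ℂ) + 2) c f) q) →
      BesselSubordination.Subordinate (BesselSubordination.besselQuot ((κ : ℂ) + 2) c g) q) := by
  open BesselSubordination in
  subst hΦ_def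
  have hα : 0 < (1 - l) / (κ + 1) := div_pos (by linarith [hl.2]) (by linarith)
  obtain ⟨hqd, hqΦ⟩ := besselQuot_add_mul_deriv hg.1.1 hg.2.2 hκ l c
  have hq : IsConvexFunction (besselQuot ((κ : ℂ) + 2) c g) :=
    ⟨hqd, fun z hz => convex_of_add_mul_deriv hα hqd hqΦ hΦ (gammaConst_le hl.2 hκ) hz⟩
  have hrefl : Subordinate (besselMix l κ c g) (besselMix l κ c g) :=
    ⟨id, differentiableOn_id, fun z _ => ⟨le_rfl, rfl⟩⟩
  have hcongr : ∀ {f h : ℂ → ℂ}, (∀ z ∈ unitDisk, f z = h z) →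
      Subordinate f (besselMix l κ c g) → Subordinate h (besselMix l κ c g) := by
    rintro f h hfh ⟨w, hw, hw'⟩
    exact ⟨w, hw, fun z hz => ⟨(hw' z hz).1, (hfh z hz).symm.trans (hw' z hz).2⟩⟩
  refine ⟨fun f hf hsub => ?_, ⟨hq.univalent_add_mul_deriv hα hqΦ, ⟨⟨hqd, hq.injOn⟩, ?_⟩, ?_⟩, ?_⟩
  · obtain ⟨hfd, hfΦ⟩ := besselQuot_add_mul_deriv hf.1.1 hf.2.2 hκ l c
    exact hq.subordinate_of_add_mul_deriv hα hqΦ hfd (hcongr hfΦ hsub)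
  · rintro ρ ⟨hρ, hsub⟩
    exact hq.subordinate_of_add_mul_deriv hα hqΦ hρ hsub
  · rintro q' ⟨-, hdom⟩
    exact hdom _ ⟨hqd, hcongr hqΦ hrefl⟩
  · intro q' _ hdom
    exact hdom g hg hrefl
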